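/- Let $\mathcal A$ be a locally finite arrangement of affine hyperplanes in $\mathbb R^r$, that is, a set of affine hyperplanes such that every open ball of $\mathbb R^r$ meets only finitely many of them. Let $\mathcal S$ be the set of regions of $\mathcal A$, i.e. of connected components of $\mathbb R^r\setminus\bigcup\mathcal A$. A facet of a region $P$ is a nonempty $(r-1)$-dimensional face of the polyhedron $\overline P$. For every ordered pair $(H,H')$ of open half-spaces separated by a hyperplane $h\in\mathcal A$, let $\tau_{H,H'}:\mathcal S\to\mathcal S$ send $P$ to $P'$ if $P\subseteq H$, $P'\subseteq H'$ and $P,P'$ share a facet included in $h$, and send $P$ to itself if there is no such $P'$. Let $\mathcal T$ be the set of all these $\tau_{H,H'}$. Theorem. The maps $\tau_{H,H'}$ are well defined (there is at most one such $P'$ for each $P$), and, if $\mathcal A\neq\varnothing$, $(\mathcal S,\mathcal T)$ is a medium. The region graph of $\mathcal A$, with vertex set $\mathcal S$ and an edge between any two distinct regions that share a facet, is the graph of this token system (that is, distinct regions $P,Q$ are adjacent if and only if $P\tau=Q$ for some $\tau\in\mathcal T$), and it is a partial cube (possibly infinite). Here a medium is a pair $(\mathcal S,\mathcal T)$ of a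 set $\mathcal S$ with more than one element and a set $\mathcal T$ of maps $\mathcal S\to\mathcal S$ (tokens), not containing the identity, that satisfies the axioms [M1]–[M4] below. We write $P\tau$ for $\tau(P)$, and $P\tau_1\cdots\tau_n$ for the result of applying $\tau_1,\dots,\tau_n$ to $P$ in this order. A token $\tau'$ is a reverse of $\tau$ if for all distinct $P,Q\in\mathcal S$: $P\tau=Q\Leftrightarrow Q\tau'=P$. A message is a finite string $m=\tau_1\cdots\tau_n$ of tokens; it produces the state $Pm$ from $P$. It is ineffective for $P$ if $Pm=P$; stepwise effective for $P$ if $P\tau_1\cdots\tau_k\neq P\tau_1\cdots\tau_{k-1}$ for $1\le k\le n$; consistent if it does not contain both a token and its reverse; straight for $P$ if it is consistent and stepwise effective for $P$; vacuous if $\{1,\dots,n\}$ can be partitioned into pairs $\{i,j\}$ such that one of $\tau_i,\tau_j$ is a reverse of the other. - [M1] Every token has a unique reverse in $\mathcal T$. - [M2] For any two distinct states $P,Q$ there is a consistent message $m$ with $Pm=Q$. - [M3] A message that is stepwise effective for a state is ineffective for that state if and only if it is vacuous. - [M4] If $m$ and $n$ are straight messages (for possibly different states) that produce the same state, then $mn$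 is consistent. A partial cube is a graph that embeds isometrically, for the graph distance, in the graph whose vertices are the finite subsets of some set $X$, two of them being adjacent if their symmetric difference is a singleton. -/

import Mathlib

namespace Media

universe u

section TokenSystems

variable {S : Type u}

/-- `τ'` is a reverse of `τ`: for all distinct states `P`, `Q`, `τ` sends `P` to `Q` if and only if
`τ'` sends `Q` to `P`. -/
def IsReverse (τ τ' : S → S) : Prop :=
  ∀ P Q : S, P ≠ Q → (τ P = Q ↔ τ' Q = P)

/-- The state produced from `P` by the message `m = τ₁ τ₂ ⋯ τₙ`; the leftmost token acts first.
A message is the list of its tokens. (The empty list satisfies the axioms of a medium below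
trivially, so admitting it as a message changes nothing.) -/
def act {T : Set (S → S)} (P : S) (m : List T) : S :=
  m.foldl (fun Q τ => τ.1 Q) P

/-- Every token of the message changes the state that it is applied to. -/
def StepwiseEffective {T : Set (S → S)} (P : S) (m : List T) : Prop :=
  ∀ k : ℕ, k < m.length → act P (m.take (k + 1)) ≠ act P (m.take k)

/-- The message does not contain both a token and a reverse of it. -/
def Consistent {T : Set (S → S)} (m : List T) : Prop :=
  ∀ τ ∈ m, ∀ τ' ∈ m, ¬ IsReverse τ.1 τ'.1

/-- A message is straight for `P` if it is consistent and stepwise effective for `P`. -/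
def Straight {T : Set (S → S)} (P : S) (m : List T) : Prop :=
  Consistent m ∧ StepwiseEffective P m

/-- The set of indices of the message can be partitioned into pairs `{i, j}` such that one of the
`i`-th and the `j`-th token is a reverse of the other. A partition into pairs is given by the
fixed-point-free involution that exchanges the two elements of each pair. -/
def Vacuous {T : Set (S → S)} (m : List T) : Prop :=
  ∃ σ : Fin m.length → Fin m.length, Function.Involutive σ ∧ (∀ i, σ i ≠ i) ∧
    ∀ i, IsReverse (m.get i).1 (m.get (σ i)).1 ∨ IsReverse (m.get (σ i)).1 (m.get i).1

/-- A set of transformations of `S` is the set of tokens of a token system with set of states `S`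
if `S` has more than one element and the identity is not a token. -/
structure IsTokenSystem (S : Type u) (T : Set (S → S)) : Prop where
  nontrivial : Nontrivial S
  id_notMem : id ∉ T

/-- The token system `(S, T)` is a medium. -/
structure IsMedium (S : Type u) (T : Set (S → S)) : Prop extends IsTokenSystem S T where
  /-- [M1] Every token has a unique reverse. -/
  existsUnique_reverse : ∀ τ : T, ∃! τ' : T, IsReverse τ.1 τ'.1
  /-- [M2] Any two distinct states are joined by a consistent message. -/
  exists_consistent : ∀ P Q : S, P ≠ Q → ∃ m : List T, Consistent m ∧ act P m = Q
  /-- [M3] A stepwise effective message for a state is ineffective for it iff it is vacuous. -/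
  ineffective_iff_vacuous : ∀ (P : S) (m : List T), StepwiseEffective P m →
    (act P m = P ↔ Vacuous m)
  /-- [M4] Two straight messages producing the same state are jointly consistent. -/
  jointly_consistent : ∀ (P Q : S) (m n : List T), Straight P m → Straight Q n →
    act P m = act Q n → Consistent (m ++ n)

end TokenSystems

section PartialCubes

/-- The cube on `X`: the vertices are the finite subsets of `X`, and two of them are adjacent if
their symmetric difference is a singleton. -/
def cube (X : Type u) : SimpleGraph (Finset X) where
  Adj P Q := ∃ x : X, symmDiff (P : Set X) (Q : Set X) = {x}
  symm := ⟨fun P Q ⟨x, hx⟩ => ⟨x, by rw [symmDiff_comm, hx]⟩⟩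
  loopless := ⟨fun P ⟨x, hx⟩ => by
    rw [symmDiff_self] at hx
    exact (Set.singleton_ne_empty x) hx.symm⟩

/-- A partial cube is a graph that embeds isometrically (for the graph distance, with the value `⊤`
between vertices that are not joined by a walk) in the cube on some set. -/
def IsPartialCube {V : Type u} (G : SimpleGraph V) : Prop :=
  ∃ (X : Type u) (f : V → Finset X), ∀ u v : V, (cube X).edist (f u) (f v) = G.edist u v

end PartialCubes

section Arrangements

variable {r : ℕ}

/-- `h` is an affine hyperplane in `ℝ^r`, and `(U, U')` is an ordered pair formed by the two open
half-spaces separated by `h`. -/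
def AreSides (h U U' : Set (EuclideanSpace ℝ (Fin r))) : Prop :=
  ∃ (a : EuclideanSpace ℝ (Fin r)) (b : ℝ), a ≠ 0 ∧
    h = {x | inner ℝ a x + b = 0} ∧ U = {x | 0 < inner ℝ a x + b} ∧
    U' = {x | inner ℝ a x + b < 0}

/-- `h` is an affine hyperplane: the zero set of a nonconstant affine function. -/
def IsAffineHyperplane (h : Set (EuclideanSpace ℝ (Fin r))) : Prop :=
  ∃ (a : EuclideanSpace ℝ (Fin r)) (b : ℝ), a ≠ 0 ∧ h = {x | inner ℝ a x + b = 0}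

/-- A locally finite arrangement: a set of affine hyperplanes such that every open ball meets only
finitely many of them. -/
structure IsLocallyFiniteArrangement (A : Set (Set (EuclideanSpace ℝ (Fin r)))) : Prop where
  isAffineHyperplane : ∀ h ∈ A, IsAffineHyperplane h
  finite_inter_ball : ∀ (x : EuclideanSpace ℝ (Fin r)) (ρ : ℝ),
    {h ∈ A | (h ∩ Metric.ball x ρ).Nonempty}.Finite

/-- The regions of `A`: the connected components of the complement of the union of `A`. -/
def regions (A : Set (Set (EuclideanSpace ℝ (Fin r)))) : Set (Set (EuclideanSpace ℝ (Fin r))) :=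
  {P | ∃ x ∈ (⋃₀ A)ᶜ, P = connectedComponentIn (⋃₀ A)ᶜ x}

/-- `F` is a facet of the region `P`: a nonempty (exposed) face of dimension `r - 1` of the
`r`-dimensional closed convex polyhedron `closure P`. -/
def IsFacet (P F : Set (EuclideanSpace ℝ (Fin r))) : Prop :=
  IsExposed ℝ (closure P) F ∧ F.Nonempty ∧ Module.finrank ℝ (vectorSpan ℝ F) + 1 = r

/-- `P` lies in `U`, `P'` lies in `U'`, and `P`, `P'` share a facet included in `h`. -/
def Crosses (h U U' P P' : Set (EuclideanSpace ℝ (Fin r))) : Prop :=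
  P ⊆ U ∧ P' ⊆ U' ∧ ∃ F, IsFacet P F ∧ IsFacet P' F ∧ F ⊆ h

open Classical in
/-- The transformation of the set of regions given by the ordered pair `(U, U')` of open half-spaces
separated by `h`: a region `P` goes to the region `P'` such that `P ⊆ U`, `P' ⊆ U'` and `P`, `P'`
share a facet included in `h`, if there is such a `P'`, and to itself otherwise. -/
noncomputable def crossing (A : Set (Set (EuclideanSpace ℝ (Fin r))))
    (h U U' : Set (EuclideanSpace ℝ (Fin r))) (P : regions A) : regions A :=
  if hP : ∃ P' : regions A, Crosses h U U' P.1 P'.1 then hP.choose else P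

/-- The tokens of `A`: the transformations given by all the ordered pairs of open half-spaces
separated by a hyperplane in `A`. -/
def tokens (A : Set (Set (EuclideanSpace ℝ (Fin r)))) : Set (regions A → regions A) :=
  {τ | ∃ h ∈ A, ∃ U U', AreSides h U U' ∧ τ = crossing A h U U'}

/-- The region graph: two distinct regions are adjacent if they share a facet. -/
def regionGraph (A : Set (Set (EuclideanSpace ℝ (Fin r)))) : SimpleGraph (regions A) where
  Adj P Q := P ≠ Q ∧ ∃ F, IsFacet P.1 F ∧ IsFacet Q.1 F
  symm := ⟨fun _ _ ⟨hne, F, hP, hQ⟩ => ⟨hne.symm, F, hQ, hP⟩⟩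
  loopless := ⟨fun _ h => h.1 rfl⟩

end Arrangements

end Media

/-! Fix an affine functional for every hyperplane and encode a region by the set of hyperplanes on
whose positive side it lies (`posSides`). The proof splits into combinatorics of such families of
sets and geometry of regions.

Combinatorics: in a well-graded family, two members are joined by a path that changes exactly the
elements on which they differ, one at a time. Hence graph distance is the size of the symmetric
difference, and translating by a base member gives an isometry into a cube
(`IsWellGraded.isPartialCube`). Tokens are labelled by an element and a direction, and reversing a
token flips the direction. Every medium axiom then becomes bookkeeping of how often each element is
added and removed (`IsWellGraded.isMedium`).

Geometry: a region is determined by its signs, and finitely many hyperplanes separate two regions. A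
segment in general position crosses these one at a time, so the family is well-graded
(`isWellGraded_posSides`). Distinct regions share a facet exactly when a single hyperplane separates
them (`regionGraph_adj_iff`), so crossing a facet is a step of the family. -/

namespace Media

universe u

/-! ### Well-graded families and graph distance -/

section WellGraded

variable {V I : Type*}

/-- A well-graded family of sets, indexed injectively by `V`: any two members differ by finitely
many elements, and one can move from one to the other by changing a single element on which they
differ. -/
structure IsWellGraded (s : V → Set I) : Prop where
  injective : Function.Injective s
  finite_symmDiff : ∀ P Q, (symmDiff (s P) (s Q)).Finite
  exists_step : ∀ P Q, P ≠ Q → ∃ h ∈ symmDiff (s P) (s Q), ∃ P', symmDiff (s P) (s P') = {h}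

theorem symmDiff_eq_diff_singleton {X Y Z : Set I} {h : I} (hXY : symmDiff X Y = {h})
    (hh : h ∈ symmDiff X Z) : symmDiff Y Z = symmDiff X Z \ {h} := by
  ext k
  have hk := Set.ext_iff.1 hXY k
  by_cases hkh : k = h
  · subst hkh
    simp only [Set.mem_symmDiff, Set.mem_singleton_iff, Set.mem_sdiff] at *
    tauto
  · simp only [Set.mem_symmDiff, Set.mem_singleton_iff, Set.mem_sdiff] at *
    tauto

/-- Induction along a path from `P` to `Q` that changes, one at a time, exactly the elements on
which `s P` and `s Q` differ. -/
theorem IsWellGraded.induction {s : V → Set I} (hs : IsWellGraded s) {Q : V} {motive : V → Prop}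
    (base : motive Q)
    (step : ∀ P P' h, h ∈ symmDiff (s P) (s Q) → symmDiff (s P) (s P') = {h} →
      symmDiff (s P') (s Q) = symmDiff (s P) (s Q) \ {h} → motive P' → motive P) (P : V) :
    motive P := by
  induction hn : (symmDiff (s P) (s Q)).ncard using Nat.strong_induction_on generalizing P with
  | _ n ih =>
    by_cases hPQ : P = Q
    · exact hPQ ▸ base
    · obtain ⟨h, hh, P', hP'⟩ := hs.exists_step P Q hPQ
      have hd := symmDiff_eq_diff_singleton hP' hh
      refine step P P' h hh hP' hd (ih _ ?_ P' rfl)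
      rw [hd, ← hn]
      exact Set.ncard_sdiff_singleton_lt_of_mem hh (hs.finite_symmDiff P Q)

/-- A path changing only the differing elements gives the upper bound. Conversely each edge of a
walk changes one element, so subadditivity of symmetric differences bounds every walk length from
below. -/
theorem IsWellGraded.edist_eq {s : V → Set I} (hs : IsWellGraded s) {G : SimpleGraph V}
    (hG : ∀ P Q, G.Adj P Q ↔ ∃ h, symmDiff (s P) (s Q) = {h}) (P Q : V) :
    G.edist P Q = (symmDiff (s P) (s Q)).encard := by
  apply le_antisymm
  · induction P using hs.induction (Q := Q) with
    | base => simp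
    | step P P' h hh hP' hd ih =>
      calc G.edist P Q ≤ G.edist P P' + G.edist P' Q := G.edist_triangle
        _ ≤ 1 + (symmDiff (s P) (s Q) \ {h}).encard := by
            refine add_le_add ?_ (hd ▸ ih)
            exact le_of_eq (SimpleGraph.edist_eq_one_iff_adj.2 ((hG P P').2 ⟨h, hP'⟩))
        _ = _ := by rw [add_comm, Set.encard_sdiff_singleton_add_one hh]
  · refine le_iInf fun w => ?_
    induction w with
    | nil => simp
    | @cons u v w huv p ih =>
      obtain ⟨h, hh⟩ := (hG u v).1 huv
      calc (symmDiff (s u) (s w)).encard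
          ≤ (symmDiff (s u) (s v) ∪ symmDiff (s v) (s w)).encard :=
            Set.encard_le_encard (symmDiff_triangle _ _ _)
        _ ≤ (symmDiff (s u) (s v)).encard + (symmDiff (s v) (s w)).encard :=
            Set.encard_union_le _ _
        _ ≤ 1 + (p.length : ℕ∞) := by
            refine add_le_add ?_ ih
            rw [hh, Set.encard_singleton]
        _ = _ := by rw [SimpleGraph.Walk.length_cons]; push_cast; ring

theorem isWellGraded_finset (X : Type*) : IsWellGraded (fun F : Finset X => (F : Set X)) where
  injective := Finset.coe_injective
  finite_symmDiff P Q := by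
    classical
    rw [← Finset.coe_symmDiff]
    exact Finset.finite_toSet _
  exists_step P Q hPQ := by
    classical
    have hne : (symmDiff (P : Set X) (Q : Set X)).Nonempty := by
      rw [Set.symmDiff_nonempty]
      exact fun h => hPQ (Finset.coe_injective h)
    obtain ⟨h, hh⟩ := hne
    refine ⟨h, hh, symmDiff P {h}, ?_⟩
    rw [Finset.coe_symmDiff, symmDiff_symmDiff_cancel_left, Finset.coe_singleton]

end WellGraded

/-- The embedding sends `P` to the symmetric difference of `s P` with `s O` for a base member `O`.
These sets are finite even if `s P` is not, and the translation preserves symmetric differences.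
Distances on both sides come from `edist_eq`, since the cube is itself well-graded. -/
theorem IsWellGraded.isPartialCube {V I : Type u} {s : V → Set I} (hs : IsWellGraded s)
    {G : SimpleGraph V} (hG : ∀ P Q, G.Adj P Q ↔ ∃ h, symmDiff (s P) (s Q) = {h}) :
    IsPartialCube G := by
  rcases isEmpty_or_nonempty V with hV | ⟨⟨O⟩⟩
  · exact ⟨I, fun _ => ∅, fun u => hV.elim u⟩
  · refine ⟨I, fun P => (hs.finite_symmDiff P O).toFinset, fun u v => ?_⟩
    rw [(isWellGraded_finset I).edist_eq (fun _ _ => Iff.rfl), hs.edist_eq hG]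
    simp only [Set.Finite.coe_toFinset]
    rw [symmDiff_comm (s v), symmDiff_assoc, symmDiff_symmDiff_cancel_left]

/-! ### Labelled steps and the transformations performing them -/

section Steps

variable {V I : Type*} {s : V → Set I}

/-- Passing from `P` to `Q` changes only the element `h`, which is added if `b` is true and removed
otherwise. -/
def IsStep (s : V → Set I) (h : I) (b : Bool) (P Q : V) : Prop :=
  symmDiff (s P) (s Q) = {h} ∧ (h ∈ s Q ↔ b = true)

theorem IsStep.mem_left_iff {h : I} {b : Bool} {P Q : V} (hPQ : IsStep s h b P Q) :
    h ∈ s P ↔ b = false := by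
  have h1 : h ∈ symmDiff (s P) (s Q) := hPQ.1 ▸ rfl
  have h2 := hPQ.2
  rw [Set.mem_symmDiff] at h1
  cases b <;> simp at * <;> tauto

theorem IsStep.mem_iff_of_ne {h k : I} {b : Bool} {P Q : V} (hPQ : IsStep s h b P Q)
    (hk : k ≠ h) : k ∈ s Q ↔ k ∈ s P := by
  have h1 : k ∉ symmDiff (s P) (s Q) := hPQ.1 ▸ hk
  rw [Set.mem_symmDiff] at h1
  tauto

theorem IsStep.ne {h : I} {b : Bool} {P Q : V} (hPQ : IsStep s h b P Q) : P ≠ Q := by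
  rintro rfl
  have := hPQ.1
  rw [symmDiff_self] at this
  exact Set.singleton_ne_empty h this.symm

theorem IsStep.symm {h : I} {b : Bool} {P Q : V} (hPQ : IsStep s h b P Q) :
    IsStep s h (!b) Q P :=
  ⟨symmDiff_comm (s P) (s Q) ▸ hPQ.1, by rw [hPQ.mem_left_iff]; simp⟩

theorem IsStep.right_unique (hs : IsWellGraded s) {h : I} {b b' : Bool} {P Q Q' : V}
    (hPQ : IsStep s h b P Q) (hPQ' : IsStep s h b' P Q') : Q = Q' :=
  hs.injective (symmDiff_right_injective (s P) (hPQ.1.trans hPQ'.1.symm))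

theorem IsStep.label_unique {h h' : I} {b b' : Bool} {P Q : V}
    (hPQ : IsStep s h b P Q) (hPQ' : IsStep s h' b' P Q) : h = h' ∧ b = b' := by
  obtain rfl : h = h' := Set.singleton_injective (hPQ.1.symm.trans hPQ'.1)
  refine ⟨rfl, ?_⟩
  rw [Bool.eq_iff_iff, ← hPQ.2, hPQ'.2]

/-- Some step of a minimal path from `P` to `Q` changes `h`; it or its reversal has the required
direction. -/
theorem IsWellGraded.exists_isStep (hs : IsWellGraded s) {h : I} {P Q : V}
    (hh : h ∈ symmDiff (s P) (s Q)) (b : Bool) : ∃ P' Q', IsStep s h b P' Q' := by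
  classical
  have key : ∃ P' Q', symmDiff (s P') (s Q') = {h} := by
    induction P using hs.induction (Q := Q) with
    | base => simp at hh
    | step P P' k hk hP' hd ih =>
      by_cases hkh : k = h
      · exact ⟨P, P', hkh ▸ hP'⟩
      · exact ih (hd ▸ ⟨hh, fun h' => hkh h'.symm⟩)
  obtain ⟨P', Q', hPQ⟩ := key
  have h1 : IsStep s h (decide (h ∈ s Q')) P' Q' := ⟨hPQ, by simp⟩
  by_cases hb : decide (h ∈ s Q') = b
  · exact ⟨P', Q', hb ▸ h1⟩
  · refine ⟨Q', P', ?_⟩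
    have : (!decide (h ∈ s Q')) = b := by revert hb; cases decide (h ∈ s Q') <;> cases b <;> simp
    exact this ▸ h1.symm

/-- The transformation `τ` performs the step with label `(h, b)` wherever it is possible, and
nothing else. -/
def Performs (s : V → Set I) (τ : V → V) (h : I) (b : Bool) : Prop :=
  ∀ P Q, P ≠ Q → (τ P = Q ↔ IsStep s h b P Q)

theorem Performs.isStep {τ : V → V} {h : I} {b : Bool} (hτ : Performs s τ h b) {P : V}
    (hP : τ P ≠ P) : IsStep s h b P (τ P) :=
  (hτ P (τ P) hP.symm).1 rfl

theorem Performs.unique {τ τ' : V → V} {h : I} {b : Bool} (hτ : Performs s τ h b)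
    (hτ' : Performs s τ' h b) : τ = τ' := by
  funext P
  by_cases h1 : τ P = P
  · by_contra hne
    have h2 : τ' P ≠ P := fun h2 => hne (h1.trans h2.symm)
    exact h2 (((hτ P _ h2.symm).2 (hτ'.isStep h2)).symm.trans h1)
  · exact ((hτ' P _ (Ne.symm h1)).2 (hτ.isStep h1)).symm

theorem Performs.isReverse {τ τ' : V → V} {h : I} {b : Bool} (hτ : Performs s τ h b)
    (hτ' : Performs s τ' h (!b)) : IsReverse τ τ' := fun P Q hPQ => by
  rw [hτ P Q hPQ, hτ' Q P hPQ.symm]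
  exact ⟨IsStep.symm, fun h1 => by simpa using h1.symm⟩

/-- One actual step, run backwards, reveals the label of a reverse. Without a step the map would be
the identity and carry no information about its label. -/
theorem Performs.isReverse_iff {τ τ' : V → V} {h h' : I} {b b' : Bool} (hτ : Performs s τ h b)
    (hτ' : Performs s τ' h' b') (hex : ∃ P Q, IsStep s h b P Q) :
    IsReverse τ τ' ↔ (h', b') = (h, !b) := by
  constructor
  · intro hrev
    obtain ⟨P, Q, hPQ⟩ := hex
    have h1 : τ' Q = P := (hrev P Q hPQ.ne).1 ((hτ P Q hPQ.ne).2 hPQ)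
    obtain ⟨rfl, rfl⟩ := hPQ.symm.label_unique ((hτ' Q P hPQ.ne.symm).1 h1)
    rfl
  · rintro ⟨⟩
    exact hτ.isReverse hτ'

end Steps

/-! ### Messages and the axioms of a medium -/

section Messages

theorem act_cons {S : Type u} {T : Set (S → S)} (P : S) (t : T) (m : List T) :
    act P (t :: m) = act (t.1 P) m := rfl

theorem stepwiseEffective_cons {S : Type u} {T : Set (S → S)} {P : S} {t : T} {m : List T} :
    StepwiseEffective P (t :: m) ↔ t.1 P ≠ P ∧ StepwiseEffective (t.1 P) m := by
  constructor
  · intro h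
    exact ⟨h 0 (by simp), fun k hk => h (k + 1) (by simpa using hk)⟩
  · rintro ⟨h0, h1⟩ (_ | k) hk
    · exact h0
    · exact h1 k (by simpa using hk)

variable {S : Type u} {I : Type*} {s : S → Set I} {T : Set (S → S)} {lab : T → I × Bool}

open Classical in
/-- The signed number of times that a label adds the element `h`. -/
noncomputable def labelWeight (h : I) (l : I × Bool) : ℤ :=
  if l.1 = h then (if l.2 = true then 1 else -1) else 0

theorem labelWeight_flip (h : I) (l : I × Bool) :
    labelWeight h (l.1, !l.2) = -labelWeight h l := by
  obtain ⟨k, b⟩ := l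
  by_cases hk : k = h <;> cases b <;> simp [labelWeight, hk]

-- The sum telescopes: each effective token contributes the change of the indicator of `h`.
open Classical in
theorem sum_labelWeight (hlab : ∀ t : T, Performs s t.1 (lab t).1 (lab t).2) (h : I) {P : S}
    {m : List T} (hm : StepwiseEffective P m) :
    (m.map fun t => labelWeight h (lab t)).sum =
      (if h ∈ s (act P m) then 1 else 0) - (if h ∈ s P then 1 else 0) := by
  induction m generalizing P with
  | nil => rw [act, List.foldl_nil, sub_self]; rfl
  | cons t m ih =>
    obtain ⟨h0, h1⟩ := stepwiseEffective_cons.1 hm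
    have hst := (hlab t).isStep h0
    rw [List.map_cons, List.sum_cons, ih h1, act_cons]
    have : labelWeight h (lab t) = (if h ∈ s (t.1 P) then 1 else 0) - (if h ∈ s P then 1 else 0) := by
      by_cases hk : h = (lab t).1
      · subst hk
        rw [if_congr hst.2 rfl rfl, if_congr hst.mem_left_iff rfl rfl]
        cases hb : (lab t).2 <;> simp [labelWeight, hb]
      · rw [if_congr (hst.mem_iff_of_ne hk) rfl rfl]
        simp [labelWeight, Ne.symm hk]
    rw [this]
    ring

theorem mem_act_of_mem (hlab : ∀ t : T, Performs s t.1 (lab t).1 (lab t).2) {h : I} {b : Bool}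
    {P : S} {m : List T} (hm : StepwiseEffective P m) (hno : ∀ t ∈ m, lab t ≠ (h, !b))
    (hP : h ∈ s P ↔ b = true) : h ∈ s (act P m) ↔ b = true := by
  induction m generalizing P with
  | nil => exact hP
  | cons t m ih =>
    obtain ⟨h0, h1⟩ := stepwiseEffective_cons.1 hm
    have hst := (hlab t).isStep h0
    refine ih h1 (fun t' ht' => hno t' (List.mem_cons_of_mem _ ht')) ?_
    by_cases hk : h = (lab t).1
    · have := hno t List.mem_cons_self
      rw [hk, hst.2]
      rw [Ne, Prod.ext_iff, not_and] at this
      have := this hk.symm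
      revert this
      cases (lab t).2 <;> cases b <;> simp
    · rw [hst.mem_iff_of_ne hk, hP]

/-- Once a token has set the status of `h`, only the opposite label could undo it. So the final
state of a straight message records the direction of every label used, which is the content of [M4].
-/
theorem mem_act_iff_of_label_mem (hlab : ∀ t : T, Performs s t.1 (lab t).1 (lab t).2) {h : I}
    {b : Bool} {P : S} {m : List T} (hm : StepwiseEffective P m)
    (hno : ∀ t ∈ m, lab t ≠ (h, !b)) (hex : ∃ t ∈ m, lab t = (h, b)) :
    h ∈ s (act P m) ↔ b = true := by
  induction m generalizing P with
  | nil => simp at hex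
  | cons t m ih =>
    obtain ⟨h0, h1⟩ := stepwiseEffective_cons.1 hm
    have hst := (hlab t).isStep h0
    have hno' : ∀ t ∈ m, lab t ≠ (h, !b) := fun t' ht' => hno t' (List.mem_cons_of_mem _ ht')
    obtain ⟨t', ht', htl⟩ := hex
    rcases List.mem_cons.1 ht' with rfl | ht'
    · rw [act_cons]
      rw [htl] at hst
      exact mem_act_of_mem (P := t'.1 P) hlab h1 hno' hst.2
    · exact ih h1 hno' ⟨t', ht', htl⟩

/-- Labels in which each element is added as often as removed can be paired with opposite labels. -/
theorem exists_involutive_of_sum_eq_zero {ι : Type*} [Fintype ι] (L : ι → I × Bool)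
    (hL : ∀ h, ∑ i, labelWeight h (L i) = 0) :
    ∃ σ : ι → ι, Function.Involutive σ ∧ ∀ i, L (σ i) = ((L i).1, !(L i).2) := by
  classical
  have hcard : ∀ h, Nonempty ({a : {i // (L i).2 = true} // (L a.1).1 = h} ≃
      {a : {i // (L i).2 = false} // (L a.1).1 = h}) := by
    intro h
    have h1 := hL h
    have h3 : ∀ l : I × Bool, labelWeight h l =
        (if l = (h, true) then 1 else 0) - (if l = (h, false) then 1 else 0) := by
      rintro ⟨k, b⟩
      by_cases hk : k = h <;> cases b <;> simp [labelWeight, hk]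
    simp only [h3, Finset.sum_sub_distrib, Finset.sum_boole, sub_eq_zero] at h1
    have h2 : ∀ b, Fintype.card {a : {i // (L i).2 = b} // (L a.1).1 = h} =
        (Finset.univ.filter fun i => L i = (h, b)).card := by
      intro b
      rw [← Fintype.card_subtype]
      refine Fintype.card_congr ((Equiv.subtypeSubtypeEquivSubtypeInter _
        (fun i => (L i).1 = h)).trans (Equiv.subtypeEquivRight fun i => ?_))
      rw [Prod.ext_iff, and_comm]
    refine ⟨Fintype.equivOfCardEq ?_⟩
    rw [h2, h2]
    exact_mod_cast h1
  -- Bijections between the additions and the removals of each single element are glued into one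
  -- bijection of all additions with all removals; `σ` is this map and its inverse.
  let e := Equiv.ofFiberEquiv (f := fun i : {i // (L i).2 = true} => (L i.1).1)
      (g := fun i : {i // (L i).2 = false} => (L i.1).1) fun h => (hcard h).some
  have he : ∀ i, (L (e i).1).1 = (L i.1).1 := fun i =>
    Equiv.ofFiberEquiv_map (f := fun i : {i // (L i).2 = true} => (L i.1).1)
      (g := fun i : {i // (L i).2 = false} => (L i.1).1) (fun h => (hcard h).some) i
  have he' : ∀ i, (L (e.symm i).1).1 = (L i.1).1 := fun i => by rw [← he, e.apply_symm_apply]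
  refine ⟨fun i => if hi : (L i).2 = true then (e ⟨i, hi⟩).1 else
    (e.symm ⟨i, by simpa using hi⟩).1, fun i => ?_, fun i => ?_⟩
  · by_cases hi : (L i).2 = true
    · have h1 : ¬ (L (e ⟨i, hi⟩).1).2 = true := by simpa using (e ⟨i, hi⟩).2
      simp only [dif_pos hi, dif_neg h1, Subtype.coe_eta, e.symm_apply_apply]
    · have h1 := (e.symm ⟨i, by simpa using hi⟩).2
      simp only [dif_neg hi, dif_pos h1, Subtype.coe_eta, e.apply_symm_apply]
  · by_cases hi : (L i).2 = true
    · simp only [dif_pos hi]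
      exact Prod.ext (he ⟨i, hi⟩) (by rw [(e ⟨i, hi⟩).2, hi]; rfl)
    · simp only [dif_neg hi]
      refine Prod.ext (he' _) ?_
      rw [(e.symm _).2]
      simpa using hi

/-- A pairing of opposite labels makes each sum equal to its own negative; conversely balanced
labels can be paired. With the telescoping sum this yields [M3]. -/
theorem vacuous_iff (hrev : ∀ t t' : T, IsReverse t.1 t'.1 ↔ lab t' = ((lab t).1, !(lab t).2))
    {m : List T} : Vacuous m ↔ ∀ h, (m.map fun t => labelWeight h (lab t)).sum = 0 := by
  have hsum : ∀ h, (m.map fun t => labelWeight h (lab t)).sum =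
      ∑ i : Fin m.length, labelWeight h (lab (m.get i)) := fun h => by
    rw [← List.sum_ofFn]
    conv_lhs => rw [← List.ofFn_get m, List.map_ofFn]
    rfl
  simp only [hsum]
  constructor
  · rintro ⟨σ, hσ, -, hr⟩ h
    have hflip : ∀ i, lab (m.get (σ i)) = ((lab (m.get i)).1, !(lab (m.get i)).2) := fun i => by
      rcases hr i with h1 | h1
      · exact (hrev _ _).1 h1
      · rw [(hrev _ _).1 h1]
        simp
    have h1 := Equiv.sum_comp (Function.Involutive.toPerm σ hσ)
      (fun i => labelWeight h (lab (m.get i)))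
    simp only [Function.Involutive.coe_toPerm, hflip, labelWeight_flip,
      Finset.sum_neg_distrib] at h1
    linarith
  · intro hz
    obtain ⟨σ, hσ, hl⟩ := exists_involutive_of_sum_eq_zero (fun i => lab (m.get i)) hz
    refine ⟨σ, hσ, fun i hi => ?_, fun i => Or.inl ((hrev _ _).2 (hl i))⟩
    have := congrArg Prod.snd (hl i)
    rw [hi] at this
    simp at this

/-- The transformations that perform the steps of a well-graded family form a medium. -/
theorem IsWellGraded.isMedium [Nontrivial S] (hs : IsWellGraded s)
    (hsep : ∀ h, ∃ P Q, h ∈ symmDiff (s P) (s Q))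
    (hT : ∀ τ ∈ T, ∃ h b, Performs s τ h b) (hT' : ∀ h b, ∃ τ ∈ T, Performs s τ h b) :
    IsMedium S T := by
  classical
  have hlabel : ∀ t : T, ∃ l : I × Bool, Performs s t.1 l.1 l.2 := fun t =>
    let ⟨h, b, hb⟩ := hT t.1 t.2
    ⟨(h, b), hb⟩
  choose lab hlab using hlabel
  have hstep : ∀ h b, ∃ P Q, IsStep s h b P Q := fun h b =>
    let ⟨_, _, h1⟩ := hsep h
    hs.exists_isStep h1 b
  have hrev : ∀ t t' : T, IsReverse t.1 t'.1 ↔ lab t' = ((lab t).1, !(lab t).2) := fun t t' =>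
    (hlab t).isReverse_iff (hlab t') (hstep _ _)
  have hlabu : ∀ (t : T) h b, Performs s t.1 h b → lab t = (h, b) := by
    intro t h b ht
    obtain ⟨P, Q, hPQ⟩ := hstep h b
    obtain ⟨h1, h2⟩ := ((hlab t P Q hPQ.ne).1 ((ht P Q hPQ.ne).2 hPQ)).label_unique hPQ
    exact Prod.ext h1 h2
  refine ⟨⟨inferInstance, fun hid => ?_⟩, fun τ => ?_, fun P Q hPQ => ?_, fun P m hm => ?_,
    fun P Q m n hm hn hPQ => ?_⟩
  · obtain ⟨h, b, hb⟩ := hT _ hid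
    obtain ⟨P, Q, hPQ⟩ := hstep h b
    exact hPQ.ne ((hb P Q hPQ.ne).2 hPQ)
  · obtain ⟨τ', hτ', hp⟩ := hT' (lab τ).1 (!(lab τ).2)
    refine ⟨⟨τ', hτ'⟩, (hlab τ).isReverse hp, fun τ'' hr => Subtype.ext ?_⟩
    have h1 := hlab τ''
    rw [(hrev _ _).1 hr] at h1
    exact h1.unique hp
  · clear hPQ
    -- On a minimal path every token moves its element to the status it has in `Q`. The direction is
    -- thus a function of the element, and no two labels are opposite.
    have key : ∃ m : List T, act P m = Q ∧ ∀ t ∈ m, (lab t).1 ∈ s Q ↔ (lab t).2 = true := by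
      induction P using hs.induction (Q := Q) with
      | base => exact ⟨[], rfl, by simp⟩
      | step P P' h hh hP' hd ih =>
        obtain ⟨m, hm, hl⟩ := ih
        obtain ⟨τ, hτ, hp⟩ := hT' h (decide (h ∈ s Q))
        have h1 : h ∉ symmDiff (s P') (s Q) := by rw [hd]; simp
        have hst : IsStep s h (decide (h ∈ s Q)) P P' := by
          refine ⟨hP', ?_⟩
          rw [Set.mem_symmDiff] at h1
          simp only [decide_eq_true_eq]
          tauto
        refine ⟨⟨τ, hτ⟩ :: m, ?_, ?_⟩
        · rw [act_cons]
          change act (τ P) m = Q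
          rw [(hp P P' hst.ne).2 hst, hm]
        · intro t ht
          rcases List.mem_cons.1 ht with rfl | ht
          · rw [hlabu _ _ _ hp]
            simp
          · exact hl t ht
    obtain ⟨m, hm, hl⟩ := key
    refine ⟨m, fun τ hτ τ' hτ' hr => ?_, hm⟩
    have h1 := hl τ hτ
    have h2 := hl τ' hτ'
    rw [(hrev _ _).1 hr, h1] at h2
    cases hb : (lab τ).2 <;> simp [hb] at h2
  · rw [vacuous_iff hrev]
    simp only [sum_labelWeight hlab _ hm, sub_eq_zero]
    refine ⟨fun h h' => by rw [h], fun h => hs.injective (Set.ext fun k => ?_)⟩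
    have := h k
    split_ifs at this <;> simp_all
  · have key : ∀ {P Q : S} {m n : List T}, Straight P m → Straight Q n → act P m = act Q n →
        ∀ τ ∈ m, ∀ τ' ∈ n, ¬ IsReverse τ.1 τ'.1 := by
      intro P Q m n hm hn hPQ τ hτ τ' hτ' hr
      have hl := (hrev _ _).1 hr
      have h1 := mem_act_iff_of_label_mem hlab (h := (lab τ).1) (b := (lab τ).2) hm.2
        (fun t ht htl => hm.1 τ hτ t ht ((hrev _ _).2 htl)) ⟨τ, hτ, rfl⟩
      have h2 := mem_act_iff_of_label_mem hlab (h := (lab τ).1) (b := !(lab τ).2) hn.2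
        (fun t ht htl => hn.1 τ' hτ' t ht ((hrev _ _).2 (by rw [hl, htl]))) ⟨τ', hτ', hl⟩
      rw [hPQ, h2] at h1
      cases hb : (lab τ).2 <;> simp [hb] at h1
    intro τ hτ τ' hτ' hr
    rcases List.mem_append.1 hτ with h1 | h1 <;> rcases List.mem_append.1 hτ' with h2 | h2
    · exact hm.1 τ h1 τ' h2 hr
    · exact key hm hn hPQ τ h1 τ' h2 hr
    · exact key hn hm hPQ.symm τ h1 τ' h2 hr
    · exact hn.1 τ h1 τ' h2 hr

end Messages

/-! ### Affine functionals: proportionality and general position -/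

section AffineFunctionals

variable {E : Type*} [NormedAddCommGroup E] [InnerProductSpace ℝ E]

theorem exists_smul_eq_of_zeros_eq {a a' : E} {b b' : ℝ} (ha : a ≠ 0) (ha' : a' ≠ 0)
    (h : {x | inner ℝ a x + b = 0} = {x | inner ℝ a' x + b' = 0}) :
    ∃ c : ℝ, c ≠ 0 ∧ ∀ x, inner ℝ a' x + b' = c * (inner ℝ a x + b) := by
  have hn : inner ℝ a a ≠ 0 := inner_self_ne_zero.2 ha
  have hx0 : inner ℝ a ((-b / inner ℝ a a) • a) + b = 0 := by
    rw [inner_smul_right]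
    field_simp
    ring
  generalize (-b / inner ℝ a a) • a = x₀ at hx0
  have hx0' : inner ℝ a' x₀ + b' = 0 := (Set.ext_iff.1 h x₀).1 hx0
  have hperp : ∀ v, inner ℝ a v = 0 → inner ℝ a' v = 0 := by
    intro v hv
    have h1 : inner ℝ a' (x₀ + v) + b' = 0 :=
      (Set.ext_iff.1 h (x₀ + v)).1 (by
        change inner ℝ a (x₀ + v) + b = 0
        rw [inner_add_right]; linarith)
    rw [inner_add_right] at h1
    linarith
  -- `c • a` is the orthogonal projection of `a'` on `a`. The remainder is orthogonal to `a`, hence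
  -- to `a'` by `hperp`, hence to itself.
  set c := inner ℝ a a' / inner ℝ a a with hc
  have hv : inner ℝ a (a' - c • a) = 0 := by
    rw [inner_sub_right, inner_smul_right, hc]
    field_simp
    ring
  have hac : a' = c • a := by
    rw [← sub_eq_zero, ← inner_self_eq_zero (𝕜 := ℝ), inner_sub_left, inner_smul_left, hv,
      hperp _ hv]
    simp
  refine ⟨c, fun h0 => ha' (by rw [hac, h0, zero_smul]), fun x => ?_⟩
  have h2 : b' = c * b := by
    have h3 := hx0'
    rw [hac, inner_smul_left] at h3
    simp only [conj_trivial] at h3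
    linear_combination h3 - c * hx0
  rw [hac, inner_smul_left, h2]
  simp only [conj_trivial]
  ring

theorem exists_mem_inner_add_ne_zero {a : E} {b : ℝ} (hne : ∃ x, inner ℝ a x + b ≠ 0) {W : Set E}
    (hW : IsOpen W) (hWn : W.Nonempty) : ∃ x ∈ W, inner ℝ a x + b ≠ 0 := by
  obtain ⟨x, hx⟩ := hWn
  by_cases h0 : inner ℝ a x + b = 0
  · obtain ⟨y, hy⟩ := hne
    -- Moving from the zero `x` towards `y`, the functional is a nonzero multiple of `t`, so any
    -- small nonzero `t` works.
    have hc : ContinuousAt (fun t : ℝ => x + t • (y - x)) 0 := by fun_prop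
    have h1 : ∀ᶠ t : ℝ in nhdsWithin 0 {0}ᶜ, x + t • (y - x) ∈ W :=
      (hc.eventually_mem (hW.mem_nhds (by simpa using hx))).filter_mono nhdsWithin_le_nhds
    obtain ⟨t, ht, ht0⟩ := (h1.and self_mem_nhdsWithin).exists
    refine ⟨_, ht, ?_⟩
    have : inner ℝ a (x + t • (y - x)) + b = t * (inner ℝ a y + b) := by
      rw [inner_add_right, inner_smul_right, inner_sub_right]
      linear_combination (1 - t) * h0
    rw [this]
    exact mul_ne_zero ht0 hy
  · exact ⟨x, hx, h0⟩

/-- A nonempty open set contains a point at which none of finitely many nonzero affine functionals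
vanishes. -/
theorem exists_mem_forall_inner_add_ne_zero {ι : Type*} {K : Set ι} (hK : K.Finite) (a : ι → E)
    (b : ι → ℝ) (hne : ∀ i ∈ K, ∃ x, inner ℝ (a i) x + b i ≠ 0) {W : Set E}
    (hW : IsOpen W) (hWn : W.Nonempty) : ∃ x ∈ W, ∀ i ∈ K, inner ℝ (a i) x + b i ≠ 0 := by
  induction K, hK using Set.Finite.induction_on generalizing W with
  | empty =>
    obtain ⟨x, hx⟩ := hWn
    exact ⟨x, hx, by simp⟩
  | @insert i K _ _ ih =>
    have ho : IsOpen (W ∩ {x | inner ℝ (a i) x + b i ≠ 0}) :=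
      hW.inter (isOpen_ne_fun (by fun_prop) (by fun_prop))
    obtain ⟨x, hx, hxi⟩ := exists_mem_inner_add_ne_zero (hne i (Set.mem_insert _ _)) hW hWn
    obtain ⟨y, hy, hyK⟩ := ih (fun j hj => hne j (Set.mem_insert_of_mem _ hj)) ho ⟨x, hx, hxi⟩
    refine ⟨y, hy.1, fun j hj => ?_⟩
    rcases Set.mem_insert_iff.1 hj with rfl | hj
    · exact hy.2
    · exact hyK j hj

end AffineFunctionals

/-! ### Regions as sign patterns -/

namespace IsLocallyFiniteArrangement

variable {r : ℕ} {A : Set (Set (EuclideanSpace ℝ (Fin r)))}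

/-- A normal vector of a hyperplane of the arrangement. -/
noncomputable def normal (hA : IsLocallyFiniteArrangement A) (h : A) : EuclideanSpace ℝ (Fin r) :=
  (hA.isAffineHyperplane h.1 h.2).choose

/-- The constant term of an affine functional vanishing on a hyperplane of the arrangement. -/
noncomputable def offset (hA : IsLocallyFiniteArrangement A) (h : A) : ℝ :=
  (hA.isAffineHyperplane h.1 h.2).choose_spec.choose

/-- An affine functional whose zero set is a given hyperplane of the arrangement. -/
noncomputable def height (hA : IsLocallyFiniteArrangement A) (h : A)
    (x : EuclideanSpace ℝ (Fin r)) : ℝ :=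
  inner ℝ (hA.normal h) x + hA.offset h

variable (hA : IsLocallyFiniteArrangement A)

theorem normal_ne_zero (h : A) : hA.normal h ≠ 0 :=
  (hA.isAffineHyperplane h.1 h.2).choose_spec.choose_spec.1

theorem coe_eq_height_eq_zero (h : A) : h.1 = {x | hA.height h x = 0} :=
  (hA.isAffineHyperplane h.1 h.2).choose_spec.choose_spec.2

theorem mem_iff_height_eq_zero {h : A} {x : EuclideanSpace ℝ (Fin r)} :
    x ∈ h.1 ↔ hA.height h x = 0 :=
  Set.ext_iff.1 (hA.coe_eq_height_eq_zero h) x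

theorem continuous_height (h : A) : Continuous (hA.height h) := by
  unfold height
  fun_prop

theorem height_add (h : A) (x v : EuclideanSpace ℝ (Fin r)) :
    hA.height h (x + v) = hA.height h x + inner ℝ (hA.normal h) v := by
  rw [height, height, inner_add_right]
  ring

theorem height_lineMap (h : A) (x y : EuclideanSpace ℝ (Fin r)) (t : ℝ) :
    hA.height h (AffineMap.lineMap x y t) = (1 - t) * hA.height h x + t * hA.height h y := by
  rw [AffineMap.lineMap_apply_module, height, height, height, inner_add_right, inner_smul_right,
    inner_smul_right]
  ring

theorem exists_height_ne_zero (h : A) : ∃ x, hA.height h x ≠ 0 := by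
  by_contra! h0
  refine hA.normal_ne_zero h (inner_self_eq_zero (𝕜 := ℝ).1 ?_)
  have h1 := hA.height_add h 0 (hA.normal h)
  rw [h0, h0] at h1
  linarith

/-- A hyperplane of the arrangement is determined by its functional up to a factor. -/
theorem eq_of_mul_height_eq {h k : A} {c d : ℝ} (hc : c ≠ 0) (hd : d ≠ 0)
    (heq : ∀ x, c * hA.height h x = d * hA.height k x) : h = k := by
  refine Subtype.ext (Set.ext fun x => ?_)
  rw [hA.mem_iff_height_eq_zero, hA.mem_iff_height_eq_zero]
  have := heq x
  constructor
  · intro h0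
    rw [h0, mul_zero] at this
    exact (mul_eq_zero.1 this.symm).resolve_left hd
  · intro h0
    rw [h0, mul_zero] at this
    exact (mul_eq_zero.1 this).resolve_left hc

theorem mem_compl_sUnion_iff {x : EuclideanSpace ℝ (Fin r)} :
    x ∈ (⋃₀ A)ᶜ ↔ ∀ h : A, hA.height h x ≠ 0 := by
  simp only [Set.mem_compl_iff, Set.mem_sUnion, not_exists, not_and, Subtype.forall,
    ne_eq, ← hA.mem_iff_height_eq_zero]

theorem finite_meeting_ball (hA : IsLocallyFiniteArrangement A) (x : EuclideanSpace ℝ (Fin r)) (ρ : ℝ) :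
    {h : A | (h.1 ∩ Metric.ball x ρ).Nonempty}.Finite := by
  refine ((hA.finite_inter_ball x ρ).preimage Subtype.val_injective.injOn).subset ?_
  intro h hh
  exact ⟨h.2, hh⟩

theorem isOpen_compl_sUnion (hA : IsLocallyFiniteArrangement A) : IsOpen (⋃₀ A)ᶜ := by
  rw [isOpen_compl_iff, Set.sUnion_eq_iUnion]
  refine LocallyFinite.isClosed_iUnion (fun x => ?_) (fun h => ?_)
  · exact ⟨Metric.ball x 1, Metric.ball_mem_nhds x one_pos, hA.finite_meeting_ball x 1⟩
  · rw [hA.coe_eq_height_eq_zero h]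
    exact isClosed_eq (hA.continuous_height h) continuous_const

theorem exists_mem_compl_sUnion (hA : IsLocallyFiniteArrangement A) {W : Set (EuclideanSpace ℝ (Fin r))} (hW : IsOpen W)
    (hWn : W.Nonempty) : ∃ x ∈ W, x ∈ (⋃₀ A)ᶜ := by
  obtain ⟨w, hw⟩ := hWn
  obtain ⟨x, hx, hxK⟩ := exists_mem_forall_inner_add_ne_zero (hA.finite_meeting_ball w 1)
    hA.normal hA.offset (fun h _ => hA.exists_height_ne_zero h) (hW.inter Metric.isOpen_ball)
    ⟨w, hw, Metric.mem_ball_self one_pos⟩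
  refine ⟨x, hx.1, hA.mem_compl_sUnion_iff.2 fun h h0 => hxK h ⟨x, ?_, hx.2⟩ h0⟩
  exact hA.mem_iff_height_eq_zero.2 h0

/-- By the intermediate value theorem no functional changes sign on a component; conversely the set
of points with the signs of `x` is convex, hence connected. -/
theorem connectedComponentIn_eq {x : EuclideanSpace ℝ (Fin r)} (hx : x ∈ (⋃₀ A)ᶜ) :
    connectedComponentIn (⋃₀ A)ᶜ x = {y | ∀ h : A, 0 < hA.height h x * hA.height h y} := by
  have hx' := hA.mem_compl_sUnion_iff.1 hx
  apply Set.Subset.antisymm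
  · intro y hy h
    by_contra hneg
    have hc : ContinuousOn (fun z => hA.height h x * hA.height h z)
        (connectedComponentIn (⋃₀ A)ᶜ x) :=
      (continuous_const.mul (hA.continuous_height h)).continuousOn
    obtain ⟨z, hz, hz0⟩ := isPreconnected_connectedComponentIn.intermediate_value hy
      (mem_connectedComponentIn hx) hc ⟨not_lt.1 hneg, mul_self_nonneg (hA.height h x)⟩
    exact mul_ne_zero (hx' h)
      (hA.mem_compl_sUnion_iff.1 (connectedComponentIn_subset _ _ hz) h) hz0
  · refine IsPreconnected.subset_connectedComponentIn (Convex.isPreconnected ?_)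
      (fun h => mul_self_pos.2 (hx' h)) ?_
    · intro y hy z hz s t hs ht hst h
      have h1 := hy h
      have h2 := hz h
      obtain rfl : s = 1 - t := by linarith
      rw [← AffineMap.lineMap_apply_module, hA.height_lineMap]
      rcases hs.eq_or_lt with h3 | h3
      · have : t = 1 := by linarith
        simpa [this] using h2
      · nlinarith [mul_pos h3 h1, mul_nonneg ht h2.le]
    · intro y hy
      exact hA.mem_compl_sUnion_iff.2 fun h h0 => by simpa [h0] using hy h

theorem region_eq (P : regions A) {x : EuclideanSpace ℝ (Fin r)} (hx : x ∈ P.1) :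
    P.1 = {y | ∀ h : A, 0 < hA.height h x * hA.height h y} := by
  obtain ⟨_, y, hy, rfl⟩ := P
  rw [← hA.connectedComponentIn_eq (connectedComponentIn_subset _ _ hx)]
  exact _root_.connectedComponentIn_eq hx

theorem isOpen_region (hA : IsLocallyFiniteArrangement A) (P : regions A) : IsOpen P.1 := by
  obtain ⟨_, y, hy, rfl⟩ := P
  exact hA.isOpen_compl_sUnion.connectedComponentIn

theorem nonempty_region (P : regions A) : P.1.Nonempty := by
  obtain ⟨_, y, hy, rfl⟩ := P
  exact ⟨y, mem_connectedComponentIn hy⟩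

theorem exists_region_mem {x : EuclideanSpace ℝ (Fin r)} (hx : x ∈ (⋃₀ A)ᶜ) :
    ∃ P : regions A, x ∈ P.1 :=
  ⟨⟨_, x, hx, rfl⟩, mem_connectedComponentIn hx⟩

theorem height_ne_zero (P : regions A) {x : EuclideanSpace ℝ (Fin r)} (hx : x ∈ P.1) (h : A) :
    hA.height h x ≠ 0 := by
  rw [hA.region_eq P hx] at hx
  exact fun h0 => by simpa [h0] using hx h

/-- The hyperplanes on whose positive side a region lies. -/
def posSides (P : regions A) : Set A := {h | ∀ x ∈ P.1, 0 < hA.height h x}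

theorem mem_posSides_iff (P : regions A) {x : EuclideanSpace ℝ (Fin r)} (hx : x ∈ P.1) {h : A} :
    h ∈ hA.posSides P ↔ 0 < hA.height h x := by
  refine ⟨fun hP => hP x hx, fun h0 y hy => ?_⟩
  rw [hA.region_eq P hx] at hy
  exact (pos_iff_pos_of_mul_pos (hy h)).1 h0

theorem notMem_posSides_iff (P : regions A) {x : EuclideanSpace ℝ (Fin r)} (hx : x ∈ P.1) {h : A} :
    h ∉ hA.posSides P ↔ hA.height h x < 0 := by
  rw [hA.mem_posSides_iff P hx, not_lt]
  exact ⟨fun h0 => lt_of_le_of_ne h0 (hA.height_ne_zero P hx h), le_of_lt⟩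

theorem mem_symmDiff_iff {P Q : regions A} {x y : EuclideanSpace ℝ (Fin r)} (hx : x ∈ P.1)
    (hy : y ∈ Q.1) {h : A} :
    h ∈ symmDiff (hA.posSides P) (hA.posSides Q) ↔ hA.height h x * hA.height h y < 0 := by
  rw [Set.mem_symmDiff, hA.notMem_posSides_iff P hx, hA.notMem_posSides_iff Q hy,
    hA.mem_posSides_iff P hx, hA.mem_posSides_iff Q hy, mul_neg_iff]
  tauto

theorem notMem_symmDiff_iff {P Q : regions A} {x y : EuclideanSpace ℝ (Fin r)} (hx : x ∈ P.1)
    (hy : y ∈ Q.1) {h : A} :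
    h ∉ symmDiff (hA.posSides P) (hA.posSides Q) ↔ 0 < hA.height h x * hA.height h y := by
  rw [hA.mem_symmDiff_iff hx hy, not_lt]
  exact ⟨fun h0 => lt_of_le_of_ne h0
    (mul_ne_zero (hA.height_ne_zero P hx h) (hA.height_ne_zero Q hy h)).symm, le_of_lt⟩

theorem posSides_injective : Function.Injective hA.posSides := by
  intro P Q hPQ
  obtain ⟨x, hx⟩ := nonempty_region P
  obtain ⟨y, hy⟩ := nonempty_region Q
  have hsame : ∀ h, 0 < hA.height h x * hA.height h y := fun h => by
    rw [← hA.notMem_symmDiff_iff hx hy, hPQ, symmDiff_self]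
    exact Set.notMem_empty h
  have hyP : y ∈ P.1 := by
    rw [hA.region_eq P hx]
    exact hsame
  exact Subtype.ext ((hA.region_eq P hyP).trans (hA.region_eq Q hy).symm)

/-- A separating hyperplane meets the segment between chosen points of the regions, which lies in a
ball. -/
theorem finite_symmDiff_posSides (P Q : regions A) :
    (symmDiff (hA.posSides P) (hA.posSides Q)).Finite := by
  obtain ⟨x, hx⟩ := nonempty_region P
  obtain ⟨y, hy⟩ := nonempty_region Q
  refine (hA.finite_meeting_ball x (dist x y + 1)).subset fun h hh => ?_
  rw [hA.mem_symmDiff_iff hx hy] at hh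
  have hc : ContinuousOn (fun z => hA.height h x * hA.height h z) (segment ℝ x y) :=
    (continuous_const.mul (hA.continuous_height h)).continuousOn
  obtain ⟨z, hz, hz0⟩ := (convex_segment x y).isPreconnected.intermediate_value
    (right_mem_segment ℝ x y) (left_mem_segment ℝ x y) hc
    ⟨hh.le, mul_self_nonneg (hA.height h x)⟩
  refine ⟨z, ?_, ?_⟩
  · rw [hA.mem_iff_height_eq_zero]
    exact (mul_eq_zero.1 hz0).resolve_left (hA.height_ne_zero P hx h)
  · have hs : segment ℝ x y ⊆ Metric.ball x (dist x y + 1) :=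
      (convex_ball x _).segment_subset (Metric.mem_ball_self (by positivity))
        (by rw [Metric.mem_ball, dist_comm]; linarith)
    exact hs hz

/-! ### Segments crossing one hyperplane at a time -/

/-- The parameter at which the segment from `x` to `y` crosses the hyperplane `h`. -/
noncomputable def crossingTime (h : A) (x y : EuclideanSpace ℝ (Fin r)) : ℝ :=
  hA.height h x / (hA.height h x - hA.height h y)

theorem crossingTime_mem_Ioo {h : A} {x y : EuclideanSpace ℝ (Fin r)}
    (hxy : hA.height h x * hA.height h y < 0) : hA.crossingTime h x y ∈ Set.Ioo 0 1 := by
  unfold crossingTime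
  rcases mul_neg_iff.1 hxy with ⟨h1, h2⟩ | ⟨h1, h2⟩
  · exact ⟨div_pos h1 (by linarith), (div_lt_one (by linarith)).2 (by linarith)⟩
  · exact ⟨div_pos_of_neg_of_neg h1 (by linarith), (div_lt_one_of_neg (by linarith)).2 (by linarith)⟩

/-- The factor before `crossingTime - t` is positive for a separating hyperplane, so the sign on the
segment depends only on whether `t` is before or after the crossing. -/
theorem height_mul_height_lineMap {h : A} {x y : EuclideanSpace ℝ (Fin r)}
    (hxy : hA.height h x * hA.height h y < 0) (t : ℝ) :
    hA.height h x * hA.height h (AffineMap.lineMap x y t) =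
      hA.height h x * (hA.height h x - hA.height h y) * (hA.crossingTime h x y - t) := by
  have hne : hA.height h x - hA.height h y ≠ 0 := by
    intro h0
    rw [sub_eq_zero.1 h0] at hxy
    exact absurd (mul_self_nonneg (hA.height h y)) (not_le.2 hxy)
  rw [hA.height_lineMap, crossingTime]
  field_simp
  ring

/-- One can choose the starting point of a segment between two regions in such a way that the
segment crosses the separating hyperplanes one at a time. -/
theorem exists_mem_crossingTime_injOn (P Q : regions A) {y : EuclideanSpace ℝ (Fin r)}
    (hy : y ∈ Q.1) : ∃ x ∈ P.1, Set.InjOn (fun h => hA.crossingTime h x y)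
      (symmDiff (hA.posSides P) (hA.posSides Q)) := by
  have hfin := hA.finite_symmDiff_posSides P Q
  -- Clearing denominators, equal crossing times mean that this functional of `x` vanishes. It is
  -- not identically zero for `h ≠ k`, since proportional functionals define the same hyperplane.
  have hform : ∀ (h k : A) x, inner ℝ (hA.height k y • hA.normal h - hA.height h y • hA.normal k) x +
      (hA.height k y * hA.offset h - hA.height h y * hA.offset k) =
      hA.height k y * hA.height h x - hA.height h y * hA.height k x := by
    intro h k x
    rw [inner_sub_left, inner_smul_left, inner_smul_left]
    simp only [height, conj_trivial]
    ring
  obtain ⟨x, hx, hne⟩ := exists_mem_forall_inner_add_ne_zero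
    (K := {i : A × A | i ∈ symmDiff (hA.posSides P) (hA.posSides Q) ×ˢ
      symmDiff (hA.posSides P) (hA.posSides Q) ∧ i.1 ≠ i.2})
    ((hfin.prod hfin).subset fun i hi => hi.1)
    (fun i => hA.height i.2 y • hA.normal i.1 - hA.height i.1 y • hA.normal i.2)
    (fun i => hA.height i.2 y * hA.offset i.1 - hA.height i.1 y * hA.offset i.2)
    (fun i hi => by
      by_contra! h0
      refine hi.2 (hA.eq_of_mul_height_eq (hA.height_ne_zero Q hy i.2)
        (hA.height_ne_zero Q hy i.1) fun x => ?_)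
      have := h0 x
      rw [hform] at this
      linarith)
    (hA.isOpen_region P) (nonempty_region P)
  refine ⟨x, hx, fun h hh k hk heq => ?_⟩
  by_contra hhk
  refine hne (h, k) ⟨⟨hh, hk⟩, hhk⟩ ?_
  rw [hform]
  have h1 := (hA.mem_symmDiff_iff hx hy).1 hh
  have h2 := (hA.mem_symmDiff_iff hx hy).1 hk
  have hn1 : hA.height h x - hA.height h y ≠ 0 := by
    intro h0
    rw [sub_eq_zero.1 h0] at h1
    exact absurd (mul_self_nonneg (hA.height h y)) (not_le.2 h1)
  have hn2 : hA.height k x - hA.height k y ≠ 0 := by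
    intro h0
    rw [sub_eq_zero.1 h0] at h2
    exact absurd (mul_self_nonneg (hA.height k y)) (not_le.2 h2)
  simp only [crossingTime] at heq
  rw [div_eq_div_iff hn1 hn2] at heq
  linear_combination -heq

/-- Stopping on a generic segment just after its first crossing, one lands in a region separated
from `P` by that hyperplane only. -/
theorem isWellGraded_posSides : IsWellGraded hA.posSides where
  injective := hA.posSides_injective
  finite_symmDiff := hA.finite_symmDiff_posSides
  exists_step P Q hPQ := by
    obtain ⟨y, hy⟩ := nonempty_region Q
    obtain ⟨x, hx, hinj⟩ := hA.exists_mem_crossingTime_injOn P Q hy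
    have hfin := hA.finite_symmDiff_posSides P Q
    have hne : (symmDiff (hA.posSides P) (hA.posSides Q)).Nonempty :=
      Set.symmDiff_nonempty.2 fun h => hPQ (hA.posSides_injective h)
    obtain ⟨h, hh, hmin⟩ := hfin.exists_minimalFor (fun h => hA.crossingTime h x y) _ hne
    have hmin' : ∀ k ∈ symmDiff (hA.posSides P) (hA.posSides Q), k ≠ h →
        hA.crossingTime h x y < hA.crossingTime k x y := by
      intro k hk hkh
      refine lt_of_le_of_ne ?_ fun heq => hkh (hinj hk hh heq.symm)
      by_contra hlt
      exact hlt (hmin hk (not_le.1 hlt).le)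
    have hh' := (hA.mem_symmDiff_iff hx hy).1 hh
    have hev : ∀ᶠ t in nhdsWithin (hA.crossingTime h x y) (Set.Ioi (hA.crossingTime h x y)),
        (∀ k ∈ symmDiff (hA.posSides P) (hA.posSides Q), k ≠ h → t < hA.crossingTime k x y) ∧
          t < 1 := by
      refine Filter.Eventually.and ((Filter.eventually_all_finite hfin).2 fun k hk => ?_) ?_
      · by_cases hkh : k = h
        · exact Filter.Eventually.of_forall fun t h0 => absurd hkh h0
        · filter_upwards [nhdsWithin_le_nhds (Iio_mem_nhds (hmin' k hk hkh))] with t ht _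
          exact ht
      · exact nhdsWithin_le_nhds (Iio_mem_nhds (hA.crossingTime_mem_Ioo hh').2)
    obtain ⟨t, ⟨htk, ht1⟩, hth⟩ := (hev.and self_mem_nhdsWithin).exists
    have ht0 : 0 < t := (hA.crossingTime_mem_Ioo hh').1.trans hth
    have hcoef : ∀ k : A, hA.height k x * hA.height k y < 0 →
        0 < hA.height k x * (hA.height k x - hA.height k y) := fun k hk => by
      nlinarith [mul_self_nonneg (hA.height k x)]
    have hsame : ∀ k ≠ h, 0 < hA.height k x * hA.height k (AffineMap.lineMap x y t) := by
      intro k hkh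
      by_cases hk : k ∈ symmDiff (hA.posSides P) (hA.posSides Q)
      · have hk' := (hA.mem_symmDiff_iff hx hy).1 hk
        rw [hA.height_mul_height_lineMap hk']
        exact mul_pos (hcoef k hk') (sub_pos.2 (htk k hk hkh))
      · rw [hA.notMem_symmDiff_iff hx hy] at hk
        rw [hA.height_lineMap, mul_add]
        have h1 := mul_self_nonneg (hA.height k x)
        nlinarith [mul_pos ht0 hk, mul_nonneg (sub_nonneg.2 ht1.le) h1]
    have hopp : hA.height h x * hA.height h (AffineMap.lineMap x y t) < 0 := by
      rw [hA.height_mul_height_lineMap hh']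
      exact mul_neg_of_pos_of_neg (hcoef h hh') (sub_neg.2 hth)
    obtain ⟨P', hP'⟩ := exists_region_mem (A := A) (x := AffineMap.lineMap x y t) <|
      hA.mem_compl_sUnion_iff.2 fun k h0 => by
        by_cases hkh : k = h
        · subst hkh
          simp [h0] at hopp
        · simpa [h0] using hsame k hkh
    refine ⟨h, hh, P', Set.ext fun k => ?_⟩
    rw [hA.mem_symmDiff_iff hx hP', Set.mem_singleton_iff]
    refine ⟨fun hk => ?_, fun hk => hk ▸ hopp⟩
    by_contra hkh
    exact absurd (hsame k hkh) hk.not_gt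

theorem exists_mem_symmDiff_posSides (h : A) :
    ∃ P Q, h ∈ symmDiff (hA.posSides P) (hA.posSides Q) := by
  have hn := inner_self_ne_zero (𝕜 := ℝ).2 (hA.normal_ne_zero h)
  have hval : ∀ c : ℝ, ∃ x, hA.height h x = c := fun c => by
    refine ⟨((c - hA.offset h) / inner ℝ (hA.normal h) (hA.normal h)) • hA.normal h, ?_⟩
    rw [height, inner_smul_right]
    field_simp
    ring
  obtain ⟨x₀, hx₀⟩ := hval 1
  obtain ⟨y₀, hy₀⟩ := hval (-1)
  obtain ⟨x, hx, hxA⟩ := hA.exists_mem_compl_sUnion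
    (isOpen_lt continuous_const (hA.continuous_height h)) (W := {x | 0 < hA.height h x})
    ⟨x₀, by simp [hx₀]⟩
  obtain ⟨y, hy, hyA⟩ := hA.exists_mem_compl_sUnion
    (isOpen_lt (hA.continuous_height h) continuous_const) (W := {x | hA.height h x < 0})
    ⟨y₀, by simp [hy₀]⟩
  obtain ⟨P, hP⟩ := exists_region_mem hxA
  obtain ⟨Q, hQ⟩ := exists_region_mem hyA
  exact ⟨P, Q, (hA.mem_symmDiff_iff hP hQ).2 (mul_neg_of_pos_of_neg hx hy)⟩

end IsLocallyFiniteArrangement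

/-! ### Closures and facets of regions -/

namespace IsLocallyFiniteArrangement

variable {r : ℕ} {A : Set (Set (EuclideanSpace ℝ (Fin r)))} (hA : IsLocallyFiniteArrangement A)

/-- Moving from `y` towards the interior point `x` turns all weak inequalities strict at once, so no
finiteness is needed. -/
theorem closure_region_eq (P : regions A) {x : EuclideanSpace ℝ (Fin r)} (hx : x ∈ P.1) :
    closure P.1 = {y | ∀ h : A, 0 ≤ hA.height h x * hA.height h y} := by
  apply Set.Subset.antisymm
  · refine closure_minimal ?_ ?_
    · rw [hA.region_eq P hx]
      exact fun y hy h => (hy h).le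
    · simp only [Set.ofPred_forall]
      exact isClosed_iInter fun h =>
        isClosed_le continuous_const (continuous_const.mul (hA.continuous_height h))
  · intro y hy
    have hc : ContinuousAt (fun t : ℝ => AffineMap.lineMap (k := ℝ) y x t) 0 := by fun_prop
    have ht : Filter.Tendsto (fun t : ℝ => AffineMap.lineMap (k := ℝ) y x t)
        (nhdsWithin 0 (Set.Ioi 0)) (nhds y) := by
      have := hc.tendsto.mono_left (nhdsWithin_le_nhds (s := Set.Ioi (0 : ℝ)))
      simpa using this
    refine mem_closure_of_tendsto ht ?_
    filter_upwards [self_mem_nhdsWithin, nhdsWithin_le_nhds (Iio_mem_nhds (zero_lt_one' ℝ))]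
      with t ht0 ht1
    rw [hA.region_eq P hx]
    intro h
    rw [hA.height_lineMap, mul_add]
    have h1 := mul_self_pos.2 (hA.height_ne_zero P hx h)
    have h2 := mul_nonneg (sub_nonneg.2 (Set.mem_Iio.1 ht1).le) (hy h)
    have h3 := mul_pos (Set.mem_Ioi.1 ht0) h1
    linarith

theorem finrank_orthogonal_normal (h : A) :
    Module.finrank ℝ (Submodule.span ℝ {hA.normal h})ᗮ + 1 = r := by
  have h1 := (Submodule.span ℝ {hA.normal h}).finrank_add_finrank_orthogonal
  rw [finrank_span_singleton (hA.normal_ne_zero h), finrank_euclideanSpace_fin] at h1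
  omega

theorem vectorSpan_le_orthogonal_normal {h : A} {F : Set (EuclideanSpace ℝ (Fin r))}
    (hF : F ⊆ h.1) : vectorSpan ℝ F ≤ (Submodule.span ℝ {hA.normal h})ᗮ := by
  rw [vectorSpan_def, Submodule.span_le]
  rintro _ ⟨x, hx, y, hy, rfl⟩
  rw [SetLike.mem_coe, Submodule.mem_orthogonal_singleton_iff_inner_right]
  have h1 := hA.mem_iff_height_eq_zero.1 (hF hx)
  have h2 := hA.mem_iff_height_eq_zero.1 (hF hy)
  unfold height at h1 h2
  simp only [vsub_eq_sub, inner_sub_right]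
  linarith

/-- At most one hyperplane of the arrangement contains a given set of codimension one. -/
theorem eq_of_subset_of_finrank (hA : IsLocallyFiniteArrangement A) {h k : A} {F : Set (EuclideanSpace ℝ (Fin r))} (hF : F.Nonempty)
    (hdim : Module.finrank ℝ (vectorSpan ℝ F) + 1 = r) (hh : F ⊆ h.1) (hk : F ⊆ k.1) : h = k := by
  -- By dimension, `F` spans the whole direction space of any hyperplane containing it.
  have key : ∀ j : A, F ⊆ j.1 → vectorSpan ℝ F = (Submodule.span ℝ {hA.normal j})ᗮ := fun j hj => by
    refine Submodule.eq_of_le_of_finrank_eq (hA.vectorSpan_le_orthogonal_normal hj) ?_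
    have := hA.finrank_orthogonal_normal j
    omega
  obtain ⟨x, hx⟩ := hF
  have hmem : ∀ j : A, F ⊆ j.1 → ∀ y, y ∈ j.1 ↔ y - x ∈ vectorSpan ℝ F := fun j hj y => by
    rw [key j hj, Submodule.mem_orthogonal_singleton_iff_inner_right, hA.mem_iff_height_eq_zero]
    have h1 := hA.mem_iff_height_eq_zero.1 (hj hx)
    unfold height at h1 ⊢
    rw [inner_sub_right]
    constructor <;> intro h2 <;> linarith
  exact Subtype.ext (Set.ext fun y => (hmem h hh y).trans (hmem k hk y).symm)

/-- A common facet of two regions lies on every hyperplane that separates them. -/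
theorem facet_subset {P Q : regions A} {F : Set (EuclideanSpace ℝ (Fin r))}
    (hP : IsFacet P.1 F) (hQ : IsFacet Q.1 F) {h : A}
    (hh : h ∈ symmDiff (hA.posSides P) (hA.posSides Q)) : F ⊆ h.1 := by
  obtain ⟨x, hx⟩ := nonempty_region P
  obtain ⟨y, hy⟩ := nonempty_region Q
  rw [hA.mem_symmDiff_iff hx hy] at hh
  intro z hz
  have h1 := hP.1.subset hz
  have h2 := hQ.1.subset hz
  rw [hA.closure_region_eq P hx] at h1
  rw [hA.closure_region_eq Q hy] at h2
  rw [hA.mem_iff_height_eq_zero]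
  by_contra h0
  -- The product of the two weak inequalities at `z` is the negative product of the heights of `x`
  -- and `y` times a square.
  have h3 := mul_nonneg (h1 h) (h2 h)
  have h4 := mul_neg_of_neg_of_pos hh (mul_self_pos.2 h0)
  linarith

theorem symmDiff_eq_singleton_of_facet {P Q : regions A} (hPQ : P ≠ Q)
    {F : Set (EuclideanSpace ℝ (Fin r))} (hP : IsFacet P.1 F) (hQ : IsFacet Q.1 F) :
    ∃ h, symmDiff (hA.posSides P) (hA.posSides Q) = {h} := by
  obtain ⟨h, hh⟩ := Set.symmDiff_nonempty.2 fun h => hPQ (hA.posSides_injective h)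
  refine ⟨h, Set.eq_singleton_iff_unique_mem.2 ⟨hh, fun k hk => ?_⟩⟩
  exact hA.eq_of_subset_of_finrank hP.2.1 hP.2.2 (hA.facet_subset hP hQ hk)
    (hA.facet_subset hP hQ hh)

/-- If only `h` separates two regions, then the point at which a segment between them meets `h`
lies in the closure of the first one. -/
theorem mem_closure_of_symmDiff_eq {P Q : regions A} {h : A}
    (hPQ : symmDiff (hA.posSides P) (hA.posSides Q) = {h}) {x y : EuclideanSpace ℝ (Fin r)}
    (hx : x ∈ P.1) (hy : y ∈ Q.1) {t : ℝ} (ht : t ∈ Set.Icc 0 1)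
    (h0 : hA.height h (AffineMap.lineMap x y t) = 0) :
    AffineMap.lineMap x y t ∈ closure P.1 := by
  rw [hA.closure_region_eq P hx]
  intro k
  by_cases hk : k = h
  · rw [hk, h0, mul_zero]
  · have h1 : k ∉ symmDiff (hA.posSides P) (hA.posSides Q) := hPQ ▸ hk
    rw [hA.notMem_symmDiff_iff hx hy] at h1
    rw [hA.height_lineMap, mul_add]
    have h2 := mul_nonneg (sub_nonneg.2 ht.2) (mul_self_nonneg (hA.height k x))
    have h3 := mul_nonneg ht.1 h1.le
    linarith

theorem isExposed_closure_inter (hA : IsLocallyFiniteArrangement A) (P : regions A) {h : A}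
    (hne : (closure P.1 ∩ h.1).Nonempty) : IsExposed ℝ (closure P.1) (closure P.1 ∩ h.1) := by
  obtain ⟨x, hx⟩ := nonempty_region P
  obtain ⟨z, hz, hzh⟩ := hne
  rw [hA.mem_iff_height_eq_zero] at hzh
  intro _
  -- Exposed faces are sets of maximizers, while the height times its sign on `P` is minimal, namely
  -- zero, on `h`; hence the minus sign.
  refine ⟨-(hA.height h x • innerSL ℝ (hA.normal h)), Set.ext fun y => ?_⟩
  have hval : ∀ w, (-(hA.height h x • innerSL ℝ (hA.normal h))) w =
      hA.height h x * hA.offset h - hA.height h x * hA.height h w := fun w => by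
    simp [height]
    ring
  simp only [hval, Set.mem_inter_iff, Set.mem_ofPred_eq, hA.mem_iff_height_eq_zero]
  refine and_congr_right fun hy => ⟨fun h0 w hw => ?_, fun hmax => ?_⟩
  · rw [hA.closure_region_eq P hx] at hw
    rw [h0]
    linarith [hw h]
  · have h1 := hmax z hz
    rw [hA.closure_region_eq P hx] at hy
    have h2 := hy h
    rw [hzh] at h1
    have h3 : hA.height h x * hA.height h y = 0 := by linarith
    exact (mul_eq_zero.1 h3).resolve_left (hA.height_ne_zero P hx h)

theorem closure_inter_eq_of_symmDiff_eq {P Q : regions A} {h : A}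
    (hPQ : symmDiff (hA.posSides P) (hA.posSides Q) = {h}) :
    closure P.1 ∩ h.1 = closure Q.1 ∩ h.1 := by
  obtain ⟨x, hx⟩ := nonempty_region P
  obtain ⟨y, hy⟩ := nonempty_region Q
  rw [hA.closure_region_eq P hx, hA.closure_region_eq Q hy]
  ext z
  simp only [Set.mem_inter_iff, Set.mem_ofPred_eq, hA.mem_iff_height_eq_zero]
  refine and_congr_left fun hz => forall_congr' fun k => ?_
  by_cases hk : k = h
  · rw [hk, hz, mul_zero, mul_zero]
  · have h1 : k ∉ symmDiff (hA.posSides P) (hA.posSides Q) := hPQ ▸ hk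
    rw [hA.notMem_symmDiff_iff hx hy] at h1
    rcases mul_pos_iff.1 h1 with ⟨h2, h3⟩ | ⟨h2, h3⟩
    · rw [mul_nonneg_iff_of_pos_left h2, mul_nonneg_iff_of_pos_left h3]
    · simp [mul_nonneg_iff, h2.not_ge, h2.le, h3.not_ge, h3.le]

/-- For the dimension, shift both ends of a crossing segment by a small vector parallel to `h`. They
stay in their open regions, and the crossing point shifts by the same vector inside the face. So
every direction of `h` lies in the span. -/
theorem isFacet_closure_inter {P Q : regions A} {h : A}
    (hPQ : symmDiff (hA.posSides P) (hA.posSides Q) = {h}) : IsFacet P.1 (closure P.1 ∩ h.1) := by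
  obtain ⟨x, hx⟩ := nonempty_region P
  obtain ⟨y, hy⟩ := nonempty_region Q
  have hh := (hA.mem_symmDiff_iff hx hy).1 (hPQ ▸ rfl : h ∈ _)
  have ht := Set.Ioo_subset_Icc_self (hA.crossingTime_mem_Ioo hh)
  set t := hA.crossingTime h x y with ht_def
  have hz0 : hA.height h (AffineMap.lineMap x y t) = 0 := by
    have h1 := hA.height_mul_height_lineMap hh t
    rw [← ht_def, sub_self, mul_zero] at h1
    exact (mul_eq_zero.1 h1).resolve_left (hA.height_ne_zero P hx h)
  have hz : AffineMap.lineMap x y t ∈ closure P.1 ∩ h.1 :=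
    ⟨hA.mem_closure_of_symmDiff_eq hPQ hx hy ht hz0, hA.mem_iff_height_eq_zero.2 hz0⟩
  refine ⟨hA.isExposed_closure_inter P ⟨_, hz⟩, ⟨_, hz⟩, ?_⟩
  suffices h1 : vectorSpan ℝ (closure P.1 ∩ h.1) = (Submodule.span ℝ {hA.normal h})ᗮ by
    rw [h1, hA.finrank_orthogonal_normal h]
  refine le_antisymm (hA.vectorSpan_le_orthogonal_normal Set.inter_subset_right) fun v hv => ?_
  rw [Submodule.mem_orthogonal_singleton_iff_inner_right] at hv
  have hshift : ∀ (R : regions A) w, w ∈ R.1 →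
      ∀ᶠ c : ℝ in nhdsWithin 0 {0}ᶜ, w + c • v ∈ R.1 := fun R w hw => by
    have hc : ContinuousAt (fun c : ℝ => w + c • v) 0 := by fun_prop
    exact (hc.eventually_mem ((hA.isOpen_region R).mem_nhds (by simpa using hw))).filter_mono
      nhdsWithin_le_nhds
  obtain ⟨c, ⟨hcx, hcy⟩, hc0⟩ := ((hshift P x hx).and (hshift Q y hy)).and
    self_mem_nhdsWithin |>.exists
  have hl : AffineMap.lineMap (x + c • v) (y + c • v) t = AffineMap.lineMap x y t + c • v := by
    simp only [AffineMap.lineMap_apply_module]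
    module
  have hlz : hA.height h (AffineMap.lineMap (x + c • v) (y + c • v) t) = 0 := by
    rw [hl, hA.height_add, hz0, inner_smul_right, hv, mul_zero, add_zero]
  have hw := hA.mem_closure_of_symmDiff_eq hPQ hcx hcy ht hlz
  have hd := vsub_mem_vectorSpan ℝ (s := closure P.1 ∩ h.1)
    ⟨hw, hA.mem_iff_height_eq_zero.2 hlz⟩ hz
  rw [hl, vsub_eq_sub, add_sub_cancel_left] at hd
  exact (Submodule.smul_mem_iff _ hc0).1 hd

theorem exists_common_facet {P Q : regions A} {h : A}
    (hPQ : symmDiff (hA.posSides P) (hA.posSides Q) = {h}) :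
    ∃ F, IsFacet P.1 F ∧ IsFacet Q.1 F ∧ F ⊆ h.1 := by
  refine ⟨closure P.1 ∩ h.1, hA.isFacet_closure_inter hPQ, ?_, Set.inter_subset_right⟩
  rw [hA.closure_inter_eq_of_symmDiff_eq hPQ]
  exact hA.isFacet_closure_inter (Q := P) (symmDiff_comm (hA.posSides P) _ ▸ hPQ)

/-! ### The region graph and the tokens as steps -/

theorem regionGraph_adj_iff (P Q : regions A) :
    (regionGraph A).Adj P Q ↔ ∃ h, symmDiff (hA.posSides P) (hA.posSides Q) = {h} := by
  constructor
  · rintro ⟨hne, F, hP, hQ⟩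
    exact hA.symmDiff_eq_singleton_of_facet hne hP hQ
  · rintro ⟨h, hh⟩
    refine ⟨?_, ?_⟩
    · rintro rfl
      rw [symmDiff_self] at hh
      exact Set.singleton_ne_empty h hh.symm
    · obtain ⟨F, hP, hQ, -⟩ := hA.exists_common_facet hh
      exact ⟨F, hP, hQ⟩

/-- Regions sharing a facet are separated by one hyperplane only, and the half-spaces force it to be
`h`. -/
theorem crosses_pos_neg_iff (h : A) (P Q : regions A) :
    Crosses h.1 {x | 0 < hA.height h x} {x | hA.height h x < 0} P.1 Q.1 ↔
      IsStep hA.posSides h false P Q := by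
  obtain ⟨y, hy⟩ := nonempty_region Q
  constructor
  · rintro ⟨hPU, hQU, F, hP, hQ, -⟩
    have hhP : h ∈ hA.posSides P := hPU
    have hhQ : h ∉ hA.posSides Q := (hA.notMem_posSides_iff Q hy).2 (hQU hy)
    obtain ⟨k, hk⟩ := hA.symmDiff_eq_singleton_of_facet
      (P := P) (Q := Q) (fun hPQ => hhQ (hPQ ▸ hhP)) hP hQ
    have hh : h ∈ symmDiff (hA.posSides P) (hA.posSides Q) := Or.inl ⟨hhP, hhQ⟩
    obtain rfl : h = k := by rwa [hk] at hh
    exact ⟨hk, by simp [hhQ]⟩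
  · intro hst
    have hhP : h ∈ hA.posSides P := hst.mem_left_iff.2 rfl
    have hhQ : h ∉ hA.posSides Q := by simp [hst.2]
    exact ⟨hhP, fun z hz => (hA.notMem_posSides_iff Q hz).1 hhQ, hA.exists_common_facet hst.1⟩

theorem crosses_neg_pos_iff (h : A) (P Q : regions A) :
    Crosses h.1 {x | hA.height h x < 0} {x | 0 < hA.height h x} P.1 Q.1 ↔
      IsStep hA.posSides h true P Q := by
  have hswap : ∀ {k U U' R R' : Set (EuclideanSpace ℝ (Fin r))},
      Crosses k U U' R R' → Crosses k U' U R' R :=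
    fun ⟨h1, h2, F, hF, hF', hk⟩ => ⟨h2, h1, F, hF', hF, hk⟩
  exact ⟨fun h1 => ((hA.crosses_pos_neg_iff h Q P).1 (hswap h1)).symm,
    fun h1 => hswap ((hA.crosses_pos_neg_iff h Q P).2 h1.symm)⟩

theorem areSides_pos_neg (h : A) :
    AreSides h.1 {x | 0 < hA.height h x} {x | hA.height h x < 0} :=
  ⟨hA.normal h, hA.offset h, hA.normal_ne_zero h, hA.coe_eq_height_eq_zero h, rfl, rfl⟩

theorem areSides_neg_pos (h : A) :
    AreSides h.1 {x | hA.height h x < 0} {x | 0 < hA.height h x} := by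
  have hneg : ∀ x, inner ℝ (-hA.normal h) x + -hA.offset h = -hA.height h x := fun x => by
    rw [inner_neg_left, height]
    ring
  refine ⟨-hA.normal h, -hA.offset h, neg_ne_zero.2 (hA.normal_ne_zero h), ?_, ?_, ?_⟩
  · simp only [hneg, neg_eq_zero]
    exact hA.coe_eq_height_eq_zero h
  · simp only [hneg, neg_pos]
  · simp only [hneg, neg_lt_zero]

/-- Any functional defining `h` is a nonzero multiple of its height; the sign of the factor decides
the case. -/
theorem eq_or_eq_of_areSides (h : A) {U U' : Set (EuclideanSpace ℝ (Fin r))}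
    (hU : AreSides h.1 U U') :
    (U = {x | 0 < hA.height h x} ∧ U' = {x | hA.height h x < 0}) ∨
      (U = {x | hA.height h x < 0} ∧ U' = {x | 0 < hA.height h x}) := by
  obtain ⟨a, b, ha, hab, rfl, rfl⟩ := hU
  obtain ⟨c, hc, hcx⟩ := exists_smul_eq_of_zeros_eq (hA.normal_ne_zero h) ha
    ((hA.coe_eq_height_eq_zero h).symm.trans hab)
  have hcx' : ∀ x, inner ℝ a x + b = c * hA.height h x := hcx
  simp only [hcx']
  rcases hc.lt_or_gt with h0 | h0
  · exact Or.inr ⟨Set.ext fun x => by simp [mul_pos_iff, h0, h0.not_gt],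
      Set.ext fun x => by simp [mul_neg_iff, h0, h0.not_gt]⟩
  · exact Or.inl ⟨Set.ext fun x => by simp [h0],
      Set.ext fun x => by simp [mul_neg_iff, h0, h0.not_gt]⟩

/-- Crossing a hyperplane from one side to the other is a step of the well-graded family of sets of
positive sides. -/
theorem exists_crosses_iff_isStep (h : A) {U U' : Set (EuclideanSpace ℝ (Fin r))}
    (hU : AreSides h.1 U U') :
    ∃ b, ∀ P Q : regions A, Crosses h.1 U U' P.1 Q.1 ↔ IsStep hA.posSides h b P Q := by
  rcases hA.eq_or_eq_of_areSides h hU with ⟨rfl, rfl⟩ | ⟨rfl, rfl⟩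
  · exact ⟨false, hA.crosses_pos_neg_iff h⟩
  · exact ⟨true, hA.crosses_neg_pos_iff h⟩

theorem exists_areSides_crosses_iff_isStep (h : A) (b : Bool) :
    ∃ U U', AreSides h.1 U U' ∧
      ∀ P Q : regions A, Crosses h.1 U U' P.1 Q.1 ↔ IsStep hA.posSides h b P Q := by
  cases b
  · exact ⟨_, _, hA.areSides_pos_neg h, hA.crosses_pos_neg_iff h⟩
  · exact ⟨_, _, hA.areSides_neg_pos h, hA.crosses_neg_pos_iff h⟩

/-- The choice made in `crossing` is harmless because a step from `P` changing `h` has a unique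
target. -/
theorem performs_crossing {h : A} {b : Bool} {U U' : Set (EuclideanSpace ℝ (Fin r))}
    (hU : ∀ P Q : regions A, Crosses h.1 U U' P.1 Q.1 ↔ IsStep hA.posSides h b P Q) :
    Performs hA.posSides (crossing A h.1 U U') h b := by
  intro P Q hPQ
  unfold crossing
  split_ifs with hex
  · have h1 := (hU _ _).1 hex.choose_spec
    exact ⟨fun h2 => h2 ▸ h1, fun h2 => h1.right_unique hA.isWellGraded_posSides h2⟩
  · exact ⟨fun h2 => absurd h2 hPQ, fun h2 => absurd ⟨Q, (hU P Q).2 h2⟩ hex⟩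

theorem exists_performs_of_mem_tokens {τ : regions A → regions A} (hτ : τ ∈ tokens A) :
    ∃ h b, Performs hA.posSides τ h b := by
  obtain ⟨h, hh, U, U', hU, rfl⟩ := hτ
  obtain ⟨b, hb⟩ := hA.exists_crosses_iff_isStep ⟨h, hh⟩ hU
  exact ⟨⟨h, hh⟩, b, hA.performs_crossing hb⟩

theorem exists_mem_tokens_performs (h : A) (b : Bool) :
    ∃ τ ∈ tokens A, Performs hA.posSides τ h b := by
  obtain ⟨U, U', hU, hb⟩ := hA.exists_areSides_crosses_iff_isStep h b
  exact ⟨_, ⟨h.1, h.2, U, U', hU, rfl⟩, hA.performs_crossing hb⟩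

theorem isMedium (hA : IsLocallyFiniteArrangement A) (hne : A.Nonempty) :
    IsMedium (regions A) (tokens A) := by
  obtain ⟨h, hh⟩ := hne
  obtain ⟨P, Q, hPQ⟩ := hA.exists_mem_symmDiff_posSides ⟨h, hh⟩
  have : Nontrivial (regions A) := ⟨P, Q, by
    rintro rfl
    simp at hPQ⟩
  exact hA.isWellGraded_posSides.isMedium hA.exists_mem_symmDiff_posSides
    (fun τ hτ => hA.exists_performs_of_mem_tokens hτ) hA.exists_mem_tokens_performs

theorem regionGraph_adj_iff_token (hA : IsLocallyFiniteArrangement A) (P Q : regions A) :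
    (regionGraph A).Adj P Q ↔ P ≠ Q ∧ ∃ τ ∈ tokens A, τ P = Q := by
  constructor
  · intro hadj
    obtain ⟨h, hh⟩ := (hA.regionGraph_adj_iff P Q).1 hadj
    classical
    obtain ⟨τ, hτ, hp⟩ := hA.exists_mem_tokens_performs h (decide (h ∈ hA.posSides Q))
    exact ⟨hadj.ne, τ, hτ, (hp P Q hadj.ne).2 ⟨hh, by simp⟩⟩
  · rintro ⟨hne, τ, hτ, hPQ⟩
    obtain ⟨h, b, hp⟩ := hA.exists_performs_of_mem_tokens hτ
    exact (hA.regionGraph_adj_iff P Q).2 ⟨h, ((hp P Q hne).1 hPQ).1⟩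

end IsLocallyFiniteArrangement

end Media

theorem mainTheorem9 (r : ℕ) (A : Set (Set (EuclideanSpace ℝ (Fin r))))
    (hA : Media.IsLocallyFiniteArrangement A) :
    -- the transformation given by an ordered pair of half-spaces is well defined
    (∀ h ∈ A, ∀ U U' : Set (EuclideanSpace ℝ (Fin r)), Media.AreSides h U U' →
      ∀ P P' P'' : Media.regions A, Media.Crosses h U U' P.1 P'.1 →
        Media.Crosses h U U' P.1 P''.1 → P' = P'') ∧
    -- the regions and the tokens form a medium
    (A.Nonempty → Media.IsMedium (Media.regions A) (Media.tokens A)) ∧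
    -- the region graph is the graph of this medium
    (∀ P Q : Media.regions A, (Media.regionGraph A).Adj P Q ↔
      P ≠ Q ∧ ∃ τ ∈ Media.tokens A, τ P = Q) ∧
    -- the region graph is a partial cube
    Media.IsPartialCube (Media.regionGraph A) := by
  refine ⟨fun h hh U U' hU P P' P'' h1 h2 => ?_, hA.isMedium, hA.regionGraph_adj_iff_token,
    hA.isWellGraded_posSides.isPartialCube hA.regionGraph_adj_iff⟩
  obtain ⟨b, hb⟩ := hA.exists_crosses_iff_isStep ⟨h, hh⟩ hU
  exact ((hb P P').1 h1).right_unique hA.isWellGraded_posSides ((hb P P'').1 h2)
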